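/- Let $R$ be a commutative noetherian ring, let $I,J$ be ideals of $R$ and let $M$ be an $R$-module (not necessarily finitely generated). Put $\tilde W(I,J)=\{\mathfrak a \text{ ideal of } R : I^n\subseteq \mathfrak a+J \text{ for some integer } n\ge 0\}$. For an $R$-module $X$ let $\Gamma_{I,J}(X)=\{x\in X : I^n x\subseteq Jx \text{ for all large } n\}$, and let $H^i_{I,J}$ be the $i$-th right derived functor of $\Gamma_{I,J}$; for $J=0$ write $\Gamma_I=\Gamma_{I,0}$ and $H^i_I=H^i_{I,0}$ (ordinary local cohomology). For $\mathfrak a\in\tilde W(I,J)$ one has $\Gamma_{\mathfrak a}\subseteq\Gamma_{\mathfrak a,J}\subseteq\Gamma_{I,J}$, which induces natural maps $H^i_{\mathfrak a}(M)\to H^i_{\mathfrak a,J}(M)\to H^i_{I,J}(M)$ and $H^i_{\mathfrak a}(M)\to H^i_{I,J}(M)$. Let $V(\mathfrak a)$ be the set of prime ideals containing $\mathfrak a$. Call $M$ a ZD-module if for every submodule $N$ of $M$ the set of zero-divisors $\{r\in R : rx=0 \text{ for some } 0\ne x\in M/N\}$ is a union of finitely many prime ideals belonging to $\mathrm{Ass}_R(M/N)$.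 Theorem. Let $t\ge 0$ be an integer such that $H^i_{I,J}(M)=0$ for all $i<t$. Then for every $\mathfrak a\in\tilde W(I,J)$ the following hold. (i) There are isomorphisms of $R$-modules $\mathrm{Hom}_R(R/\mathfrak a,H^t_{\mathfrak a}(M))\cong \mathrm{Ext}^t_R(R/\mathfrak a,M)\cong \mathrm{Hom}_R(R/\mathfrak a,H^t_{\mathfrak a,J}(M))\cong \mathrm{Hom}_R(R/\mathfrak a,H^t_{I,J}(M))$. (ii) There are isomorphisms of $R$-modules $\Gamma_{\mathfrak a}(H^t_{\mathfrak a}(M))\cong H^t_{\mathfrak a}(M)\cong\Gamma_{\mathfrak a}(H^t_{\mathfrak a,J}(M))\cong\Gamma_{\mathfrak a}(H^t_{I,J}(M))$. (iii) $H^i_{\mathfrak a}(M)\subseteq H^i_{\mathfrak a,J}(M)$ for all $i\le t$. (iv) $H^i_{\mathfrak a,J}(M)\subseteq H^i_{I,J}(M)$ for all $i\le t$. (v) $H^i_{\mathfrak a}(M)\subseteq H^i_{I,J}(M)$ for all $i\le t$. (In (iii)--(v), "$\subseteq$" means that the natural map is injective.) (vi) $H^i_{\mathfrak a,J}(M)=H^i_{\mathfrak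 a}(M)=0$ for all $i<t$. (vii) $\mathrm{Ass}(H^t_{\mathfrak a}(M))=\mathrm{Ass}(H^t_{\mathfrak a,J}(M))\cap V(\mathfrak a)=\mathrm{Ass}(H^t_{I,J}(M))\cap V(\mathfrak a)$. (viii) If $\mathfrak a\ne 0$ and $M$ is a ZD-module, then there are $x_1,\dots,x_t\in\mathfrak a$ such that $x_j$ is a non-zero-divisor on $M/(x_1,\dots,x_{j-1})M$ for $j=1,\dots,t$; if moreover $\mathfrak aM\ne M$, then these can be chosen with, in addition, $M\ne(x_1,\dots,x_t)M$, i.e. forming an $M$-regular sequence in the strict sense. -/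

import Mathlib

open CategoryTheory

universe u

namespace PairLocalCohomology

section Torsion

variable {R : Type*} [CommRing R] {M N : Type*} [AddCommGroup M] [Module R M]
  [AddCommGroup N] [Module R N]

/-- The set `W̃(I, J)` of all ideals `a` of `R` such that `I ^ n ⊆ a + J` for some `n`. -/
def WTilde (I J : Ideal R) : Set (Ideal R) :=
  {a | ∃ n : ℕ, I ^ n ≤ a ⊔ J}

/-- `I ^ n x ⊆ J x` says the same as `I ^ n ⊆ J + Ann(x)`. -/
theorem pow_smul_span_le_iff (I J : Ideal R) (x : M) (n : ℕ) :
    I ^ n • Submodule.span R {x} ≤ J • Submodule.span R {x} ↔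
      I ^ n ≤ J ⊔ Ideal.torsionOf R M x := by
  rw [Submodule.smul_le]
  constructor
  · intro h r hr
    obtain ⟨j, hj, hjx⟩ := Submodule.mem_smul_span_singleton.1
      (h r hr x (Submodule.mem_span_singleton_self x))
    refine Submodule.mem_sup.2 ⟨j, hj, r - j, ?_, by ring⟩
    rw [Ideal.mem_torsionOf_iff, sub_smul, hjx, sub_self]
  · intro h r hr y hy
    obtain ⟨c, rfl⟩ := Submodule.mem_span_singleton.1 hy
    obtain ⟨j, hj, k, hk, rfl⟩ := Submodule.mem_sup.1 (h hr)
    rw [Ideal.mem_torsionOf_iff] at hk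
    refine Submodule.mem_smul_span_singleton.2 ⟨j * c, J.mul_mem_right c hj, ?_⟩
    rw [add_smul, smul_comm k c x, hk, smul_zero, add_zero, mul_smul]

/-- The `(I, J)`-torsion submodule `Γ_{I,J}(M)`: all `x` in `M` with `I ^ n x ⊆ J x` for some `n`
(equivalently, for all large `n`, since `I ^ n x` decreases with `n`). -/
def torsion (I J : Ideal R) (M : Type*) [AddCommGroup M] [Module R M] : Submodule R M where
  carrier := {x | ∃ n : ℕ, I ^ n • Submodule.span R {x} ≤ J • Submodule.span R {x}}
  zero_mem' := ⟨0, by simp⟩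
  add_mem' := by
    rintro x y ⟨n, hn⟩ ⟨m, hm⟩
    rw [pow_smul_span_le_iff] at hn hm
    refine ⟨n + m, (pow_smul_span_le_iff I J (x + y) (n + m)).2 ?_⟩
    rw [pow_add]
    refine (Ideal.mul_mono hn hm).trans ?_
    rw [Ideal.sup_mul, Ideal.mul_sup, Ideal.mul_sup]
    refine sup_le (sup_le ?_ ?_) (sup_le ?_ ?_)
    · exact le_sup_of_le_left Ideal.mul_le_right
    · exact le_sup_of_le_left Ideal.mul_le_left
    · exact le_sup_of_le_left Ideal.mul_le_right
    · refine le_sup_of_le_right (Ideal.mul_le.2 fun r hr s hs => ?_)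
      rw [Ideal.mem_torsionOf_iff] at hr hs ⊢
      rw [smul_add, mul_comm, mul_smul, hr, smul_zero, zero_add, mul_comm, mul_smul, hs,
        smul_zero]
  smul_mem' := by
    rintro c x ⟨n, hn⟩
    rw [pow_smul_span_le_iff] at hn
    refine ⟨n, (pow_smul_span_le_iff I J (c • x) n).2 (hn.trans (sup_le_sup_left ?_ J))⟩
    intro r hr
    rw [Ideal.mem_torsionOf_iff] at hr ⊢
    rw [smul_comm, hr, smul_zero]

theorem mem_torsion_iff {I J : Ideal R} {x : M} :
    x ∈ torsion I J M ↔ ∃ n : ℕ, I ^ n ≤ J ⊔ Ideal.torsionOf R M x :=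
  exists_congr fun n => pow_smul_span_le_iff I J x n

/-- For `J = 0` one gets the usual `I`-torsion submodule `Γ_I(M)`. -/
theorem mem_torsion_bot_iff {I : Ideal R} {x : M} :
    x ∈ torsion I ⊥ M ↔ ∃ n : ℕ, ∀ r ∈ I ^ n, r • x = 0 := by
  rw [mem_torsion_iff]
  refine exists_congr fun n => ?_
  rw [bot_sup_eq]
  rfl

theorem map_mem_torsion (I J : Ideal R) (f : M →ₗ[R] N) {x : M} (hx : x ∈ torsion I J M) :
    f x ∈ torsion I J N := by
  rw [mem_torsion_iff] at hx ⊢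
  obtain ⟨n, hn⟩ := hx
  refine ⟨n, hn.trans (sup_le_sup_left (fun r hr => ?_) J)⟩
  rw [Ideal.mem_torsionOf_iff] at hr ⊢
  rw [← map_smul, hr, map_zero]

theorem torsion_bot_le (a J : Ideal R) (M : Type*) [AddCommGroup M] [Module R M] :
    torsion a ⊥ M ≤ torsion a J M := by
  intro x hx
  rw [mem_torsion_iff] at hx ⊢
  obtain ⟨n, hn⟩ := hx
  exact ⟨n, hn.trans (sup_le_sup_right bot_le _)⟩

theorem torsion_le_of_mem_WTilde {I J a : Ideal R} (ha : a ∈ WTilde I J)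
    (M : Type*) [AddCommGroup M] [Module R M] : torsion a J M ≤ torsion I J M := by
  intro x hx
  rw [mem_torsion_iff] at hx ⊢
  obtain ⟨m, hm⟩ := ha
  obtain ⟨n, hn⟩ := hx
  refine ⟨m * (n + 1), ?_⟩
  rw [pow_mul]
  refine (Ideal.pow_right_mono hm (n + 1)).trans (Ideal.sup_pow_add_le_pow_sup_pow.trans ?_)
  rw [pow_one]
  exact sup_le hn le_sup_left

/-- `M` is a ZD-module: for every submodule `N`, the set of zero-divisors on `M ⧸ N` is the union
of finitely many associated primes of `M ⧸ N`. -/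
def IsZDModule (R M : Type*) [CommRing R] [AddCommGroup M] [Module R M] : Prop :=
  ∀ N : Submodule R M, ∃ S : Set (Ideal R), S.Finite ∧ S ⊆ associatedPrimes R (M ⧸ N) ∧
    {r : R | ∃ x : M ⧸ N, x ≠ 0 ∧ r • x = 0} = ⋃ p ∈ S, (p : Set R)

end Torsion

noncomputable section Functors

variable {R : Type u} [CommRing R]

/-- The `(I, J)`-torsion functor `Γ_{I,J}` on `R`-modules. -/
def torsionFunctor (I J : Ideal R) : ModuleCat.{u} R ⥤ ModuleCat.{u} R where
  obj M := ModuleCat.of R (torsion I J M)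
  map f := ModuleCat.ofHom (f.hom.restrict fun _ hx => map_mem_torsion I J f.hom hx)

instance (I J : Ideal R) : (torsionFunctor I J).Additive where

/-- The natural transformation `Γ_{I,J} ⟶ Γ_{I',J'}` given by inclusions of submodules. -/
def torsionInclusion {I J I' J' : Ideal R}
    (h : ∀ M : ModuleCat.{u} R, torsion I J M ≤ torsion I' J' M) :
    torsionFunctor I J ⟶ torsionFunctor I' J' where
  app M := ModuleCat.ofHom (Submodule.inclusion (h M))

/-- Local cohomology `H^i_{I,J}(M)` with respect to the pair `(I, J)`: the `i`-th right derived
functor of `Γ_{I,J}`, at `M`. -/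
abbrev pairH (I J : Ideal R) (i : ℕ) (M : Type u) [AddCommGroup M] [Module R M] :
    ModuleCat.{u} R :=
  ((torsionFunctor I J).rightDerived i).obj (ModuleCat.of R M)

/-- Ordinary local cohomology `H^i_a(M)`: the `i`-th right derived functor of the ordinary
`a`-torsion functor `Γ_a = Γ_{a,0}`, at `M`. -/
abbrev ordH (a : Ideal R) (i : ℕ) (M : Type u) [AddCommGroup M] [Module R M] :
    ModuleCat.{u} R :=
  pairH a ⊥ i M

/-- The natural map `H^i_a(M) ⟶ H^i_{a,J}(M)` induced by the inclusion `Γ_a ⊆ Γ_{a,J}`. -/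
def ordToPair (a J : Ideal R) (i : ℕ) (M : Type u) [AddCommGroup M] [Module R M] :
    ordH a i M ⟶ pairH a J i M :=
  (NatTrans.rightDerived (torsionInclusion fun M => torsion_bot_le a J M) i).app
    (ModuleCat.of R M)

/-- For `a ∈ W̃(I, J)`, the natural map `H^i_{a,J}(M) ⟶ H^i_{I,J}(M)` induced by the inclusion
`Γ_{a,J} ⊆ Γ_{I,J}`. -/
def pairToPair {I J a : Ideal R} (ha : a ∈ WTilde I J) (i : ℕ)
    (M : Type u) [AddCommGroup M] [Module R M] :
    pairH a J i M ⟶ pairH I J i M :=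
  (NatTrans.rightDerived (torsionInclusion fun M => torsion_le_of_mem_WTilde ha M) i).app
    (ModuleCat.of R M)

/-- For `a ∈ W̃(I, J)`, the natural map `H^i_a(M) ⟶ H^i_{I,J}(M)` induced by the inclusion
`Γ_a ⊆ Γ_{I,J}`. -/
def ordToPairOfMem {I J a : Ideal R} (ha : a ∈ WTilde I J) (i : ℕ)
    (M : Type u) [AddCommGroup M] [Module R M] :
    ordH a i M ⟶ pairH I J i M :=
  (NatTrans.rightDerived (torsionInclusion fun M =>
    (torsion_bot_le a J M).trans (torsion_le_of_mem_WTilde ha M)) i).app (ModuleCat.of R M)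

end Functors

end PairLocalCohomology

/-! Take a minimal injective resolution `E⁰ → E¹ → …` of `M`, with cosyzygies `C⁰ = M` and `Cⁿ⁺¹ =
Eⁿ / Cⁿ`, where `Eⁿ` is an injective hull of `Cⁿ`. As `Cⁿ` is essential in `Eⁿ`, the torsion `Γ(Eⁿ)`
vanishes as soon as `Γ(Cⁿ)` does. If `Γ` kills `E⁰, …, Eⁿ⁻¹`, there are no boundaries in degree `n`,
and left exactness gives `Hⁿ(M) ≅ Γ(Cⁿ)`. Induction then turns the vanishing of `H^i_{I,J}(M)` for
`i < t` into `Γ_{I,J}(Eⁱ) = 0` for `i < t` (`torsion_hull_cosyzygy_eq_bot`). The smaller functors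
`Γ_{a,J}` and `Γ_a` kill the same `Eⁱ`.

Hence the three cohomology modules in degree `t` are the submodules `Γ_a(C) ⊆ Γ_{a,J}(C) ⊆
Γ_{I,J}(C)` of the single module `C = Cᵗ`, and the natural maps are the inclusions. `Hom(R/a, -)`,
`Γ_a` and `Ass ∩ V(a)` detect only elements of `Γ_a(C)`, so they agree on all three. Since `Hom(R/a,
Eⁱ) = 0` for `i < t`, dimension shifting gives `Extᵗ(R/a, M) ≅ Hom(R/a, C)`.

For (viii), `Extⁱ(R/a, M) = 0` for `i < t`; the ZD condition permits prime avoidance, and the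
regular sequence is built by induction. -/

namespace PairLocalCohomology

/-! ### Injective hulls as maximal essential extensions. -/

section Hull

variable {R : Type u} [CommRing R]

theorem injective_of_retraction {E F : Type u} [AddCommGroup E] [Module R E] [AddCommGroup F]
    [Module R F] [Module.Injective R E] (s : F →ₗ[R] E) (r : E →ₗ[R] F)
    (hrs : ∀ x, r (s x) = x) : Module.Injective R F where
  out X Y _ _ _ _ f hf g := by
    obtain ⟨h, hh⟩ := Module.Injective.out f hf (s ∘ₗ g)
    exact ⟨r ∘ₗ h, fun x => by simp [hh, hrs]⟩

/-- The extension `A ≤ F` of submodules is essential. -/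
def IsEssentialIn {E : Type*} [AddCommGroup E] [Module R E] (A F : Submodule R E) : Prop :=
  A ≤ F ∧ ∀ N ≤ F, Disjoint N A → N = ⊥

theorem exists_maximal_isEssentialIn {E : Type*} [AddCommGroup E] [Module R E]
    (A : Submodule R E) : ∃ F, Maximal (IsEssentialIn A) F := by
  obtain ⟨F, -, hF⟩ := zorn_le_nonempty₀ {F : Submodule R E | IsEssentialIn A F} (by
    intro c hc hchain y hy
    refine ⟨sSup c, ⟨(hc hy).1.trans (le_sSup hy), fun N hN hNA => ?_⟩, fun z hz => le_sSup hz⟩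
    -- Intersection distributes over directed suprema, so essentiality passes to the union of a
    -- chain.
    have : N ⊓ sSup c = ⊥ := by
      rw [DirectedOn.inf_sSup_eq hchain.directedOn]
      simp only [iSup_eq_bot]
      exact fun F hF => (hc hF).2 _ inf_le_right (hNA.mono_left inf_le_left)
    rwa [inf_eq_left.2 hN] at this) A ⟨le_rfl, fun N hN h => h.eq_bot_of_le hN⟩
  exact ⟨F, hF⟩

theorem exists_maximal_disjoint {E : Type*} [AddCommGroup E] [Module R E]
    (F : Submodule R E) : ∃ N, Maximal (fun N => Disjoint N F) N := by
  obtain ⟨N, -, hN⟩ := zorn_le_nonempty₀ {N : Submodule R E | Disjoint N F} (by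
    intro c hc hchain y hy
    refine ⟨sSup c, ?_, fun z hz => le_sSup hz⟩
    exact (hchain.directedOn.disjoint_sSup_left).2 fun N hN => hc hN) ⊥ disjoint_bot_left
  exact ⟨N, hN⟩

/-- A maximal essential extension of a submodule inside an injective module is injective. -/
theorem injective_of_maximal_isEssentialIn {E : Type u} [AddCommGroup E] [Module R E]
    [Module.Injective R E] {A F : Submodule R E} (hF : Maximal (IsEssentialIn A) F) :
    Module.Injective R F := by
  obtain ⟨N, hN⟩ := exists_maximal_disjoint F
  have hdis : Disjoint N F := hN.prop
  let f : F →ₗ[R] E ⧸ N := N.mkQ ∘ₗ F.subtype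
  have hf : Function.Injective f := by
    rw [← LinearMap.ker_eq_bot, eq_bot_iff]
    rintro ⟨x, hx⟩ hxN
    have : x ∈ N := by simpa [f] using hxN
    simpa using Submodule.disjoint_def.1 hdis x this hx
  -- Maximality of `N` makes the image of `F` essential in `E ⧸ N`. An extension `g` of the
  -- inclusion of `F` is therefore injective.
  have hess : ∀ K : Submodule R (E ⧸ N), (∀ x : F, f x ∈ K → x = 0) → K = ⊥ := by
    intro K hK
    have h1 : Disjoint (K.comap N.mkQ) F := by
      rw [Submodule.disjoint_def]
      intro x hx hxF
      simpa using hK ⟨x, hxF⟩ hx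
    have h2 : K.comap N.mkQ ≤ N := hN.le_of_ge h1 (Submodule.le_comap_mkQ N K)
    rw [eq_bot_iff]
    intro y hy
    obtain ⟨x, rfl⟩ := N.mkQ_surjective y
    simpa using h2 hy
  obtain ⟨g, hg⟩ := Module.Injective.out f hf F.subtype
  have hginj : LinearMap.ker g = ⊥ := by
    refine hess _ fun x hx => ?_
    have := hg x
    rw [LinearMap.mem_ker.1 hx] at this
    simpa using this.symm
  have hFg : F ≤ LinearMap.range g := fun x hx => ⟨f ⟨x, hx⟩, hg ⟨x, hx⟩⟩
  -- The range of `g` is again an essential extension of `A`, so it cannot exceed `F`; thus `g ∘ₗ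
  -- N.mkQ` retracts `E` onto `F`.
  have hrange : LinearMap.range g ≤ F := by
    refine hF.le_of_ge ⟨hF.prop.1.trans hFg, fun K hK hKA => ?_⟩ hFg
    have h1 : K ⊓ F = ⊥ := hF.prop.2 _ inf_le_right (hKA.mono_left inf_le_left)
    have h2 : K.comap g = ⊥ := by
      refine hess _ fun x hx => ?_
      have h3 : (x : E) ∈ K ⊓ F := ⟨by simpa [hg x] using hx, x.2⟩
      rw [h1] at h3
      simpa using h3
    rw [eq_bot_iff]
    intro y hy
    obtain ⟨z, rfl⟩ := hK hy
    have h4 : z ∈ K.comap g := hy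
    rw [h2] at h4
    simp [(Submodule.mem_bot R).1 h4]
  refine injective_of_retraction F.subtype
    (LinearMap.codRestrict F (g ∘ₗ N.mkQ) fun x => hrange ⟨_, rfl⟩) fun x => ?_
  exact Subtype.ext (hg x)

theorem exists_injective_hull (X : ModuleCat.{u} R) :
    ∃ (E : ModuleCat.{u} R) (f : X ⟶ E), Injective E ∧ Mono f ∧
      ∀ N : Submodule R E, Disjoint N (LinearMap.range f.hom) → N = ⊥ := by
  let E₀ := Injective.under X
  let i : X ⟶ E₀ := Injective.ι X
  have hi : Function.Injective i := (ModuleCat.mono_iff_injective i).1 inferInstance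
  have : Module.Injective R E₀ := by
    have : Injective (ModuleCat.of R E₀) := inferInstanceAs (Injective (Injective.under X))
    exact Module.injective_module_of_injective_object R E₀
  obtain ⟨F, hF⟩ := exists_maximal_isEssentialIn (LinearMap.range i.hom)
  have hmem : ∀ x, i.hom x ∈ F := fun x => hF.prop.1 ⟨x, rfl⟩
  have := injective_of_maximal_isEssentialIn hF
  refine ⟨ModuleCat.of R F, ModuleCat.ofHom (LinearMap.codRestrict F i.hom hmem),
    Module.injective_object_of_injective_module R F, ?_, fun N hN => ?_⟩
  · rw [ModuleCat.mono_iff_injective]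
    exact fun x y hxy => hi (congrArg Subtype.val hxy)
  · have h1 : N.map F.subtype = ⊥ := by
      refine hF.prop.2 _ (Submodule.map_subtype_le F N) ?_
      rw [Submodule.disjoint_def]
      rintro _ ⟨y, hy, rfl⟩ ⟨x, hx⟩
      have h2 : y = 0 := Submodule.disjoint_def.1 hN y hy ⟨x, Subtype.ext hx⟩
      simp [h2]
    exact Submodule.map_injective_of_injective F.injective_subtype
      (h1.trans (Submodule.map_bot _).symm)

end Hull

/-! ### The minimal injective resolution. -/

noncomputable section

variable {R : Type u} [CommRing R]

/-- An injective hull of a module. -/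
def hull (X : ModuleCat.{u} R) : ModuleCat.{u} R := (exists_injective_hull X).choose

/-- The embedding of a module into its injective hull. -/
def hullι (X : ModuleCat.{u} R) : X ⟶ hull X := (exists_injective_hull X).choose_spec.choose

instance (X : ModuleCat.{u} R) : Injective (hull X) :=
  (exists_injective_hull X).choose_spec.choose_spec.1

instance (X : ModuleCat.{u} R) : Mono (hullι X) :=
  (exists_injective_hull X).choose_spec.choose_spec.2.1

theorem eq_bot_of_disjoint_hullι {X : ModuleCat.{u} R} {N : Submodule R (hull X)}
    (hN : Disjoint N (LinearMap.range (hullι X).hom)) : N = ⊥ :=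
  (exists_injective_hull X).choose_spec.choose_spec.2.2 N hN

/-- The `n`-th cosyzygy of a module in its minimal injective resolution. -/
def cosyzygy (M : ModuleCat.{u} R) : ℕ → ModuleCat.{u} R
  | 0 => M
  | n + 1 => Limits.cokernel (hullι (cosyzygy M n))

/-- The projection from the `n`-th term of the minimal injective resolution. -/
def cosyzygyπ (M : ModuleCat.{u} R) (n : ℕ) : hull (cosyzygy M n) ⟶ cosyzygy M (n + 1) :=
  Limits.cokernel.π (hullι (cosyzygy M n))

@[simp]
theorem hullι_cosyzygyπ (M : ModuleCat.{u} R) (n : ℕ) :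
    hullι (cosyzygy M n) ≫ cosyzygyπ M n = 0 :=
  Limits.cokernel.condition _

theorem cosyzygy_shortExact (M : ModuleCat.{u} R) (n : ℕ) :
    (ShortComplex.mk _ _ (hullι_cosyzygyπ M n)).ShortExact where
  exact := ShortComplex.exact_cokernel _
  mono_f := inferInstanceAs (Mono (hullι _))
  epi_g := inferInstanceAs (Epi (Limits.cokernel.π _))

/-- The minimal injective resolution of a module, as a complex. -/
def minimalCocomplex (M : ModuleCat.{u} R) : CochainComplex (ModuleCat.{u} R) ℕ :=
  CochainComplex.of (fun n => hull (cosyzygy M n))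
    (fun n => cosyzygyπ M n ≫ hullι (cosyzygy M (n + 1)))
    (fun n => by rw [Category.assoc, ← Category.assoc (hullι _), hullι_cosyzygyπ,
      Limits.zero_comp, Limits.comp_zero])

theorem minimalCocomplex_d (M : ModuleCat.{u} R) (n : ℕ) :
    (minimalCocomplex M).d n (n + 1) = cosyzygyπ M n ≫ hullι (cosyzygy M (n + 1)) :=
  CochainComplex.of_d (fun n => hull (cosyzygy M n))
    (fun n => cosyzygyπ M n ≫ hullι (cosyzygy M (n + 1))) n

theorem hullι_minimalCocomplex_d (M : ModuleCat.{u} R) (n : ℕ) :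
    (hullι (cosyzygy M n) : _ ⟶ (minimalCocomplex M).X n) ≫
      (minimalCocomplex M).d n (n + 1) = 0 := by
  rw [minimalCocomplex_d]
  exact (Category.assoc _ _ _).symm.trans
    ((congrArg (· ≫ _) (hullι_cosyzygyπ M n)).trans Limits.zero_comp)

/-- Following the cokernel projection by the monomorphism into the next hull does not change its
kernel. -/
theorem hullι_exact (M : ModuleCat.{u} R) (n : ℕ) :
    (ShortComplex.mk _ _ (hullι_minimalCocomplex_d M n)).Exact := by
  let α : ShortComplex.mk _ _ (hullι_cosyzygyπ M n) ⟶
      ShortComplex.mk _ _ (hullι_minimalCocomplex_d M n) :=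
    { τ₁ := 𝟙 _
      τ₂ := 𝟙 _
      τ₃ := hullι _
      comm₁₂ := (Category.id_comp _).trans (Category.comp_id _).symm
      comm₂₃ := (Category.id_comp _).trans (minimalCocomplex_d M n) }
  have : Epi α.τ₁ := inferInstanceAs (Epi (𝟙 _))
  have : IsIso α.τ₂ := inferInstanceAs (IsIso (𝟙 _))
  have : Mono α.τ₃ := inferInstanceAs (Mono (hullι _))
  exact (ShortComplex.exact_iff_of_epi_of_isIso_of_mono α).1 (cosyzygy_shortExact M n).exact

theorem minimalCocomplex_exactAt_succ (M : ModuleCat.{u} R) (n : ℕ) :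
    (minimalCocomplex M).ExactAt (n + 1) := by
  rw [HomologicalComplex.exactAt_iff' _ n (n + 1) (n + 1 + 1) (by simp) (by simp)]
  let α : (minimalCocomplex M).sc' n (n + 1) (n + 1 + 1) ⟶
      ShortComplex.mk _ _ (hullι_minimalCocomplex_d M (n + 1)) :=
    { τ₁ := cosyzygyπ M n
      τ₂ := 𝟙 _
      τ₃ := 𝟙 _
      comm₁₂ := (minimalCocomplex_d M n).symm.trans (Category.comp_id _).symm
      comm₂₃ := (Category.id_comp _).trans (Category.comp_id _).symm }
  have : Epi α.τ₁ := (cosyzygy_shortExact M n).epi_g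
  have : IsIso α.τ₂ := inferInstanceAs (IsIso (𝟙 _))
  have : Mono α.τ₃ := inferInstanceAs (Mono (𝟙 _))
  exact (ShortComplex.exact_iff_of_epi_of_isIso_of_mono α).2 (hullι_exact M (n + 1))

/-- The minimal injective resolution of a module. -/
def minimalResolution (M : ModuleCat.{u} R) : InjectiveResolution M where
  cocomplex := minimalCocomplex M
  injective n := inferInstanceAs (Injective (hull _))
  ι := (CochainComplex.fromSingle₀Equiv _ _).symm
    ⟨hullι (cosyzygy M 0), hullι_minimalCocomplex_d M 0⟩
  quasiIso := ⟨fun n => by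
    cases n
    · rw [CochainComplex.quasiIsoAt₀_iff, ShortComplex.quasiIso_iff_of_zeros]
      · refine (ShortComplex.exact_and_mono_f_iff_of_iso ?_).2
          ⟨hullι_exact M 0, inferInstanceAs (Mono (hullι _))⟩
        exact ShortComplex.isoMk (Iso.refl _) (Iso.refl _) (Iso.refl _)
          ((Category.id_comp _).trans (Category.comp_id _).symm)
          ((Category.id_comp _).trans (Category.comp_id _).symm)
      all_goals rfl
    · rw [quasiIsoAt_iff_exactAt]
      · apply minimalCocomplex_exactAt_succ
      · apply CochainComplex.exactAt_succ_single_obj⟩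

end

noncomputable section

variable {R : Type u} [CommRing R]

/-! ### Derived functors from the cycles of a resolution. -/

section Derived

theorem isIso_liftCycles {C : Type*} [Category* C] [Abelian C] (K : CochainComplex C ℕ) {n : ℕ}
    {Z : C} (φ : Z ⟶ K.X n) [hm : Mono φ] (h : φ ≫ K.d n (n + 1) = 0)
    (hex : (ShortComplex.mk _ _ h).Exact) :
    IsIso (K.liftCycles φ (n + 1) (by simp) h) := by
  have : Mono (ShortComplex.mk _ _ h).f := hm
  refine ⟨hex.lift (K.iCycles n) (K.iCycles_d n (n + 1)), ?_, ?_⟩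
  · rw [← cancel_mono φ, Category.assoc, Category.id_comp]
    exact (congrArg _ (hex.lift_f _ (K.iCycles_d n (n + 1)))).trans (K.liftCycles_i _ _ _ _)
  · rw [← cancel_mono (K.iCycles n), Category.assoc, HomologicalComplex.liftCycles_i,
      Category.id_comp]
    exact hex.lift_f _ (K.iCycles_d n (n + 1))

variable {C D : Type*} [Category* C] [Abelian C] [Category* D] [Abelian D]
  (F G : C ⥤ D) [F.Additive] [G.Additive] {X : C} (P : InjectiveResolution X) {n : ℕ} {Z : C}
  (φ : Z ⟶ P.cocomplex.X n)

/-- The image of a morphism to a term of a resolution, with target in the image complex. -/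
def mapToX : F.obj Z ⟶ ((F.mapHomologicalComplex _).obj P.cocomplex).X n := F.map φ

theorem mapToX_d (h : φ ≫ P.cocomplex.d n (n + 1) = 0) :
    mapToX F P φ ≫ ((F.mapHomologicalComplex _).obj P.cocomplex).d n (n + 1) = 0 :=
  (F.map_comp _ _).symm.trans ((congrArg F.map h).trans (F.map_zero _ _))

variable [HasInjectiveResolutions C] (h : φ ≫ P.cocomplex.d n (n + 1) = 0)

/-- The derived functor of `F` is the homology of the image of an injective resolution. -/
def homologyIsoRightDerived :
    ((F.mapHomologicalComplex _).obj P.cocomplex).homology n ≅ (F.rightDerived n).obj X :=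
  (P.isoRightDerivedObj F n).symm

theorem homologyIsoRightDerived_naturality (α : F ⟶ G) :
    (homologyIsoRightDerived F P).hom ≫ (NatTrans.rightDerived α n).app X =
      HomologicalComplex.homologyMap ((NatTrans.mapHomologicalComplex α _).app P.cocomplex) n ≫
        (homologyIsoRightDerived G P).hom := by
  have h3 := InjectiveResolution.rightDerived_app_eq α P n
  rw [← Iso.inv_comp_eq] at h3
  exact h3

/-- The map from `F` of an object mapping to the cycles of an injective resolution to the
derived functor of `F`. -/
def cyclesToDerived : F.obj Z ⟶ (F.rightDerived n).obj X :=
  ((F.mapHomologicalComplex _).obj P.cocomplex).liftCycles (mapToX F P φ) (n + 1) (by simp)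
      (mapToX_d F P φ h) ≫
    ((F.mapHomologicalComplex _).obj P.cocomplex).homologyπ n ≫
      (homologyIsoRightDerived F P).hom

/-- This identifies the natural maps between cohomology modules with inclusions of torsion
submodules of a cosyzygy. -/
theorem cyclesToDerived_naturality (α : F ⟶ G) :
    cyclesToDerived F P φ h ≫ (NatTrans.rightDerived α n).app X =
      α.app Z ≫ cyclesToDerived G P φ h := by
  have h1 : ((F.mapHomologicalComplex _).obj P.cocomplex).liftCycles (mapToX F P φ) (n + 1)
      (by simp) (mapToX_d F P φ h) ≫ HomologicalComplex.cyclesMap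
        ((NatTrans.mapHomologicalComplex α _).app P.cocomplex) n =
      α.app Z ≫ ((G.mapHomologicalComplex _).obj P.cocomplex).liftCycles (mapToX G P φ) (n + 1)
        (by simp) (mapToX_d G P φ h) := by
    rw [← cancel_mono (HomologicalComplex.iCycles _ _), Category.assoc, Category.assoc,
      HomologicalComplex.cyclesMap_i, HomologicalComplex.liftCycles_i,
      HomologicalComplex.liftCycles_i_assoc]
    exact α.naturality _
  rw [cyclesToDerived, cyclesToDerived, Category.assoc, Category.assoc,
    homologyIsoRightDerived_naturality, ← reassoc_of% h1,
    HomologicalComplex.homologyπ_naturality_assoc]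

theorem isIso_cyclesToDerived [Mono (mapToX F P φ)]
    (hF : (ShortComplex.mk _ _ (mapToX_d F P φ h)).Exact)
    (hz : ∀ j < n, Limits.IsZero (F.obj (P.cocomplex.X j))) :
    IsIso (cyclesToDerived F P φ h) := by
  have h1 := isIso_liftCycles ((F.mapHomologicalComplex _).obj P.cocomplex) (mapToX F P φ) _ hF
  have h2 : IsIso (((F.mapHomologicalComplex _).obj P.cocomplex).homologyπ n) := by
    refine HomologicalComplex.isIso_homologyπ _ _ n rfl ?_
    cases n with
    -- The predecessor of `0` defaults to `0`, and the differential from degree `0` to itself is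
    -- zero.
    | zero => exact HomologicalComplex.shape _ _ _ (by simp)
    | succ k =>
      rw [CochainComplex.prev_nat_succ]
      exact (hz k k.lt_succ_self).eq_of_src _ _
  have h3 : IsIso (homologyIsoRightDerived F P (n := n)).hom := inferInstance
  exact IsIso.comp_isIso' h1 (IsIso.comp_isIso' h2 h3)

end Derived

/-! ### Torsion of cosyzygies and local cohomology. -/

section Torsion

/-- The map from the torsion of a cosyzygy to local cohomology. -/
def torsionToH (I J : Ideal R) (M : ModuleCat.{u} R) (n : ℕ) :
    (torsionFunctor I J).obj (cosyzygy M n) ⟶ ((torsionFunctor I J).rightDerived n).obj M :=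
  cyclesToDerived (torsionFunctor I J) (minimalResolution M) (hullι (cosyzygy M n))
    (hullι_minimalCocomplex_d M n)

theorem torsionOf_map_injective {M N : Type*} [AddCommGroup M] [Module R M] [AddCommGroup N]
    [Module R N] (f : M →ₗ[R] N) (hf : Function.Injective f) (x : M) :
    Ideal.torsionOf R N (f x) = Ideal.torsionOf R M x := by
  ext r
  rw [Ideal.mem_torsionOf_iff, Ideal.mem_torsionOf_iff, ← map_smul, map_eq_zero_iff f hf]

theorem map_mem_torsion_iff (I J : Ideal R) {M N : Type*} [AddCommGroup M] [Module R M]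
    [AddCommGroup N] [Module R N] (f : M →ₗ[R] N) (hf : Function.Injective f) {x : M} :
    f x ∈ torsion I J N ↔ x ∈ torsion I J M := by
  rw [mem_torsion_iff, mem_torsion_iff, torsionOf_map_injective f hf]

instance (I J : Ideal R) : (torsionFunctor I J).PreservesMonomorphisms where
  preserves {X Y} f hf := by
    rw [ModuleCat.mono_iff_injective] at hf ⊢
    exact fun x y hxy => Subtype.ext (hf (congrArg Subtype.val hxy))

/-- Left exactness: membership in the torsion depends only on the annihilator, which an injective
map preserves. -/
theorem torsionFunctor_map_exact (I J : Ideal R) (M : ModuleCat.{u} R) (n : ℕ) :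
    (ShortComplex.mk _ _ (mapToX_d (torsionFunctor I J)
      (minimalResolution M) _ (hullι_minimalCocomplex_d M n))).Exact := by
  rw [ShortComplex.moduleCat_exact_iff]
  rintro ⟨x, hx⟩ hx0
  obtain ⟨y, hy⟩ := (ShortComplex.moduleCat_exact_iff _).1 (hullι_exact M n) x
    (congrArg Subtype.val hx0)
  have hinj : Function.Injective (hullι (cosyzygy M n)).hom :=
    (ModuleCat.mono_iff_injective _).1 inferInstance
  have hyt : y ∈ torsion I J (cosyzygy M n) := by
    rw [← map_mem_torsion_iff I J (hullι (cosyzygy M n)).hom hinj]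
    exact hy ▸ hx
  exact ⟨⟨y, hyt⟩, Subtype.ext hy⟩

theorem isZero_torsionFunctor_iff (I J : Ideal R) (X : ModuleCat.{u} R) :
    Limits.IsZero ((torsionFunctor I J).obj X) ↔ torsion I J X = ⊥ := by
  rw [ModuleCat.isZero_iff_subsingleton, ← Submodule.subsingleton_iff_eq_bot]
  rfl

/-- The torsion of the hull meets `X` in the torsion of `X`, so essentiality forces it to vanish. -/
theorem torsion_hull_eq_bot {I J : Ideal R} {X : ModuleCat.{u} R} (h : torsion I J X = ⊥) :
    torsion I J (hull X) = ⊥ := by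
  refine eq_bot_of_disjoint_hullι ?_
  rw [Submodule.disjoint_def]
  rintro _ hx ⟨y, rfl⟩
  rw [map_mem_torsion_iff I J _ ((ModuleCat.mono_iff_injective _).1 inferInstance), h,
    Submodule.mem_bot] at hx
  rw [hx, map_zero]

theorem torsion_eq_bot_of_hull {I J : Ideal R} {X : ModuleCat.{u} R}
    (h : torsion I J (hull X) = ⊥) : torsion I J X = ⊥ := by
  rw [eq_bot_iff]
  intro x hx
  have := map_mem_torsion I J (hullι X).hom hx
  rwa [h, Submodule.mem_bot, map_eq_zero_iff _ ((ModuleCat.mono_iff_injective _).1 inferInstance)]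
    at this

theorem isIso_torsionToH {I J : Ideal R} {M : ModuleCat.{u} R} {n : ℕ}
    (h : ∀ j < n, torsion I J (hull (cosyzygy M j)) = ⊥) :
    IsIso (torsionToH I J M n) :=
  haveI : Mono (mapToX (torsionFunctor I J) (minimalResolution M) (hullι (cosyzygy M n))) :=
    inferInstanceAs (Mono ((torsionFunctor I J).map (hullι (cosyzygy M n))))
  isIso_cyclesToDerived _ _ _ _ (torsionFunctor_map_exact I J M n) fun j hj =>
    (isZero_torsionFunctor_iff I J _).2 (h j hj)

theorem torsion_hull_cosyzygy_eq_bot {I J : Ideal R} {M : ModuleCat.{u} R} {t : ℕ}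
    (h : ∀ i < t, Limits.IsZero (((torsionFunctor I J).rightDerived i).obj M)) :
    ∀ i < t, torsion I J (hull (cosyzygy M i)) = ⊥ := by
  intro i
  induction i using Nat.strong_induction_on with
  | _ i ih =>
    intro hi
    have := isIso_torsionToH fun j hj => ih j hj (hj.trans hi)
    exact torsion_hull_eq_bot ((isZero_torsionFunctor_iff I J _).1
      ((h i hi).of_iso (asIso (torsionToH I J M i))))

theorem isZero_rightDerived_torsionFunctor {I J : Ideal R} {M : ModuleCat.{u} R} {n : ℕ}
    (h : ∀ j ≤ n, torsion I J (hull (cosyzygy M j)) = ⊥) :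
    Limits.IsZero (((torsionFunctor I J).rightDerived n).obj M) := by
  have := isIso_torsionToH fun j hj => h j (le_of_lt hj)
  refine Limits.IsZero.of_iso ?_ (asIso (torsionToH I J M n)).symm
  exact (isZero_torsionFunctor_iff I J _).2 (torsion_eq_bot_of_hull (h n le_rfl))

theorem injective_rightDerived_torsionInclusion {I J I' J' : Ideal R}
    (hle : ∀ M : ModuleCat.{u} R, torsion I J M ≤ torsion I' J' M) {M : ModuleCat.{u} R} {n : ℕ}
    (h : ∀ j < n, torsion I' J' (hull (cosyzygy M j)) = ⊥) :
    Function.Injective ((NatTrans.rightDerived (torsionInclusion hle) n).app M) := by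
  have := isIso_torsionToH h
  have := isIso_torsionToH fun j hj =>
    eq_bot_iff.2 ((hle (hull (cosyzygy M j))).trans (h j hj).le)
  have hn : torsionToH I J M n ≫ (NatTrans.rightDerived (torsionInclusion hle) n).app M =
      (torsionInclusion hle).app (cosyzygy M n) ≫ torsionToH I' J' M n :=
    cyclesToDerived_naturality _ _ _ _ _ _
  have hm : Mono ((torsionInclusion hle).app (cosyzygy M n)) := by
    rw [ModuleCat.mono_iff_injective]
    exact Submodule.inclusion_injective (hle _)
  rw [← ModuleCat.mono_iff_injective, ← (Iso.inv_comp_eq (asIso (torsionToH I J M n))).2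
    hn.symm]
  infer_instance

end Torsion

end

/-! ### Invariants that see only the `a`-torsion. -/

section TorsionEquiv

variable {R : Type*} [CommRing R] {M N : Type*} [AddCommGroup M] [Module R M]
  [AddCommGroup N] [Module R N]

/-- A linear equivalence restricts to torsion submodules. -/
noncomputable def torsionCongr (I J : Ideal R) (e : M ≃ₗ[R] N) :
    torsion I J M ≃ₗ[R] torsion I J N :=
  e.ofSubmodules _ _ (by
    ext y
    rw [Submodule.mem_map_equiv, ← map_mem_torsion_iff I J e.toLinearMap e.injective]
    simp)

/-- A submodule containing the whole `(I, J)`-torsion has the same `(I, J)`-torsion. -/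
noncomputable def torsionSubmoduleEquiv (I J : Ideal R) {T : Submodule R M}
    (hT : torsion I J M ≤ T) : torsion I J T ≃ₗ[R] torsion I J M :=
  (LinearEquiv.ofEq _ _ (by
    ext x
    exact (map_mem_torsion_iff I J T.subtype T.injective_subtype).symm)).trans
    (Submodule.comapSubtypeEquivOfLe hT)

theorem mem_torsion_bot_of_linearMap {a : Ideal R} (f : (R ⧸ a) →ₗ[R] M) (y : R ⧸ a) :
    f y ∈ torsion a ⊥ M := by
  rw [mem_torsion_bot_iff]
  refine ⟨1, fun r hr => ?_⟩
  obtain ⟨s, rfl⟩ := Ideal.Quotient.mk_surjective y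
  rw [pow_one] at hr
  rw [← map_smul, Algebra.smul_def, Ideal.Quotient.algebraMap_eq, ← map_mul,
    Ideal.Quotient.eq_zero_iff_mem.2 (a.mul_mem_right s hr), map_zero]

/-- Linear maps from `R ⧸ a` take values in any submodule containing the `a`-torsion. -/
noncomputable def homSubmoduleEquiv {a : Ideal R} {T : Submodule R M}
    (hT : torsion a ⊥ M ≤ T) : ((R ⧸ a) →ₗ[R] T) ≃ₗ[R] ((R ⧸ a) →ₗ[R] M) where
  toFun f := T.subtype ∘ₗ f
  map_add' f g := LinearMap.comp_add _ _ _
  map_smul' r f := LinearMap.comp_smul _ _ _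
  invFun f := f.codRestrict T fun y => hT (mem_torsion_bot_of_linearMap f y)
  left_inv f := by ext; rfl
  right_inv f := by ext; rfl

/-- An element whose annihilator is a prime containing `a` is killed by `a`, so it already lies in
`T`. -/
theorem associatedPrimes_torsion_inter [IsNoetherianRing R] {a : Ideal R} {T : Submodule R M}
    (hT : torsion a ⊥ M ≤ T) :
    associatedPrimes R T ∩ {p | a ≤ p} = associatedPrimes R M ∩ {p | a ≤ p} := by
  ext p
  refine and_congr_left fun hp => ⟨fun h => h.map_of_injective T.subtype T.injective_subtype,
    fun h => ?_⟩
  obtain ⟨hpp, x, hx⟩ := isAssociatedPrime_iff.1 h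
  have hxT : x ∈ T := by
    refine hT (mem_torsion_bot_iff.2 ⟨1, fun r hr => ?_⟩)
    rw [pow_one] at hr
    have : r ∈ p := hp hr
    rw [hx] at this
    simpa [Submodule.mem_colon_singleton] using this
  refine isAssociatedPrime_iff.2 ⟨hpp, ⟨x, hxT⟩, ?_⟩
  rw [hx]
  ext r
  simp [Submodule.mem_colon_singleton, Subtype.ext_iff]

theorem le_of_mem_associatedPrimes_torsion [IsNoetherianRing R] {a p : Ideal R}
    (h : p ∈ associatedPrimes R (torsion a ⊥ M)) : a ≤ p := by
  obtain ⟨hpp, x, hx⟩ := isAssociatedPrime_iff.1 h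
  obtain ⟨n, hn⟩ := mem_torsion_bot_iff.1 x.2
  refine hpp.le_of_pow_le (n := n) fun r hr => ?_
  rw [hx, Submodule.mem_colon_singleton, Submodule.mem_bot]
  exact Subtype.ext (hn r hr)

end TorsionEquiv

/-! ### ZD-modules and prime avoidance. -/

section ZD

variable {R : Type*} [CommRing R] {M N : Type*} [AddCommGroup M] [Module R M]
  [AddCommGroup N] [Module R N]

theorem zeroDivisors_congr (e : M ≃ₗ[R] N) :
    {r : R | ∃ x : M, x ≠ 0 ∧ r • x = 0} = {r : R | ∃ x : N, x ≠ 0 ∧ r • x = 0} := by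
  ext r
  refine e.exists_congr_left.trans (exists_congr fun y => ?_)
  simp [← map_smul]

theorem IsZDModule.of_surjective (h : IsZDModule R M) (f : M →ₗ[R] N)
    (hf : Function.Surjective f) : IsZDModule R N := by
  intro K
  obtain ⟨S, hS, hSass, hSeq⟩ := h (K.comap f)
  have e : (M ⧸ K.comap f) ≃ₗ[R] N ⧸ K :=
    (Submodule.quotEquivOfEq _ _ (by rw [LinearMap.ker_comp, Submodule.ker_mkQ])).trans
      ((K.mkQ ∘ₗ f).quotKerEquivOfSurjective (K.mkQ_surjective.comp hf))
  exact ⟨S, hS, LinearEquiv.AssociatedPrimes.eq e ▸ hSass, (zeroDivisors_congr e).symm.trans hSeq⟩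

/-- Prime avoidance for modules whose zero-divisors form a finite union of associated primes. -/
theorem IsZDModule.exists_isSMulRegular [IsNoetherianRing R] (h : IsZDModule R M) {a : Ideal R}
    (ha : torsion a ⊥ M = ⊥) : ∃ r ∈ a, IsSMulRegular M r := by
  obtain ⟨S, hS, hSass, hSeq⟩ := h ⊥
  have e := Submodule.quotEquivOfEqBot (⊥ : Submodule R M) rfl
  rw [zeroDivisors_congr e] at hSeq
  rw [LinearEquiv.AssociatedPrimes.eq e] at hSass
  by_contra! hcon
  have hsub : (a : Set R) ⊆ ⋃ p ∈ (hS.toFinset : Set (Ideal R)), (p : Set R) := by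
    rw [hS.coe_toFinset, ← hSeq]
    intro r hr
    have h1 := hcon r hr
    rw [isSMulRegular_iff_right_eq_zero_of_smul] at h1
    push Not at h1
    obtain ⟨x, hx0, hx⟩ := h1
    exact ⟨x, hx, hx0⟩
  -- Prime avoidance tolerates two non-prime members; all members here are prime, so both
  -- exceptional indices are the dummy `⊥`.
  obtain ⟨p, hp, hap⟩ := (Ideal.subset_union_prime (f := fun p : Ideal R => p) ⊥ ⊥
    fun p hp _ _ => (hSass (hS.mem_toFinset.1 hp)).isPrime).1 hsub
  obtain ⟨hpp, x, hx⟩ := isAssociatedPrime_iff.1 (hSass (hS.mem_toFinset.1 hp))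
  have hxt : x ∈ torsion a ⊥ M := by
    refine mem_torsion_bot_iff.2 ⟨1, fun r hr => ?_⟩
    rw [pow_one] at hr
    have : r ∈ p := hap hr
    rw [hx] at this
    simpa [Submodule.mem_colon_singleton] using this
  rw [ha, Submodule.mem_bot] at hxt
  refine hpp.ne_top ?_
  rw [hx, hxt, Ideal.eq_top_iff_one]
  simp [Submodule.mem_colon_singleton]

end ZD

/-! ### Dimension shifting for `Ext` and regular sequences. -/

noncomputable section Ext

open Abelian

variable {R : Type u} [CommRing R]

/-- Dimension shifting for `Ext` along an injective object receiving no maps. -/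
def extShift (X : ModuleCat.{u} R) {S : ShortComplex (ModuleCat.{u} R)} (hS : S.ShortExact)
    [Injective S.X₂] (h0 : ∀ f : X ⟶ S.X₂, f = 0) (n : ℕ) :
    Ext X S.X₃ n ≃ₗ[R] Ext X S.X₁ (n + 1) :=
  -- Injectivity of the middle term says nothing about degree `0`; there `h0` supplies the
  -- vanishing.
  have hz : ∀ x : Ext X S.X₂ n, x = 0 := fun x => by
    cases n with
    | zero =>
      obtain ⟨f, rfl⟩ := Ext.addEquiv₀.symm.surjective x
      rw [h0 f, map_zero]
    | succ k => exact Ext.eq_zero_of_injective x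
  LinearEquiv.ofBijective
    { toFun := fun x => x.comp hS.extClass rfl
      map_add' := fun x y => by simp
      map_smul' := fun r x => by simp }
    ⟨by
      rw [← LinearMap.ker_eq_bot, eq_bot_iff]
      intro x hx
      obtain ⟨y, rfl⟩ := Ext.covariant_sequence_exact₃ X hS x rfl hx
      rw [hz y, Ext.zero_comp]
      exact zero_mem _, fun x =>
      Ext.covariant_sequence_exact₁ X hS x (Ext.eq_zero_of_injective _) rfl⟩

theorem hom_quotient_eq_zero {a : Ideal R} {E : ModuleCat.{u} R} (hE : torsion a ⊥ E = ⊥)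
    (f : ModuleCat.of R (R ⧸ a) ⟶ E) : f = 0 := by
  refine ModuleCat.hom_ext (LinearMap.ext fun y => ?_)
  have := mem_torsion_bot_of_linearMap f.hom y
  rwa [hE, Submodule.mem_bot] at this

theorem nonempty_ext_cosyzygy_equiv {a : Ideal R} {M : ModuleCat.{u} R} {t : ℕ}
    (h : ∀ i < t, torsion a ⊥ (hull (cosyzygy M i)) = ⊥) (s j : ℕ) (hsj : s + j = t) :
    Nonempty (Ext (ModuleCat.of R (R ⧸ a)) M t ≃ₗ[R]
      Ext (ModuleCat.of R (R ⧸ a)) (cosyzygy M s) j) := by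
  induction s generalizing j with
  | zero =>
    rw [zero_add] at hsj
    subst hsj
    exact ⟨LinearEquiv.refl R _⟩
  | succ s ih =>
    obtain ⟨e⟩ := ih (j + 1) (by lia)
    exact ⟨e.trans (extShift (S := ShortComplex.mk _ _ (hullι_cosyzygyπ M s)) _
      (cosyzygy_shortExact M s) (hom_quotient_eq_zero (h s (by lia))) j).symm⟩

theorem nonempty_ext_equiv_linearMap {a : Ideal R} {M : ModuleCat.{u} R} {t : ℕ}
    (h : ∀ i < t, torsion a ⊥ (hull (cosyzygy M i)) = ⊥) :
    Nonempty (Ext (ModuleCat.of R (R ⧸ a)) M t ≃ₗ[R] ((R ⧸ a) →ₗ[R] cosyzygy M t)) := by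
  obtain ⟨e⟩ := nonempty_ext_cosyzygy_equiv h t 0 (by simp)
  exact ⟨(e.trans Ext.linearEquiv₀).trans ModuleCat.homLinearEquiv⟩

/-- Nonzero `a`-torsion would have an associated prime, necessarily containing `a`; an element with
that annihilator defines a nonzero map from `R ⧸ a`. -/
theorem torsion_bot_eq_bot_of_subsingleton_ext {a : Ideal R} {M : ModuleCat.{u} R}
    [Subsingleton (Ext (ModuleCat.of R (R ⧸ a)) M 0)] [IsNoetherianRing R] :
    torsion a ⊥ M = ⊥ := by
  by_contra hne
  have := Submodule.nontrivial_iff_ne_bot.2 hne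
  obtain ⟨p, hp⟩ := associatedPrimes.nonempty R (torsion a ⊥ M)
  have hap := le_of_mem_associatedPrimes_torsion hp
  obtain ⟨hpp, x, hx⟩ := isAssociatedPrime_iff.1 hp
  let f : (R ⧸ a) →ₗ[R] M := a.liftQ (LinearMap.toSpanSingleton R M x) fun r hr => by
    have : r ∈ p := hap hr
    rw [hx] at this
    exact congrArg Subtype.val ((Submodule.mem_bot R).1 (Submodule.mem_colon_singleton.1 this))
  have hf : ModuleCat.ofHom f = 0 := Ext.addEquiv₀.symm.injective (Subsingleton.elim _ _)
  have hx0 : (x : M) = 0 := by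
    have : f (Ideal.Quotient.mk a 1) = 0 := congrArg (fun g => g.hom (Ideal.Quotient.mk a 1)) hf
    exact (one_smul R (x : M)).symm.trans this
  refine hpp.ne_top ?_
  rw [hx, Ideal.eq_top_iff_one]
  simpa [Submodule.mem_colon_singleton] using hx0

/-- Once `r ∈ a` is regular on `M`, the long exact sequence places `Ext i` of `M / rM` between `Ext
i` and `Ext (i + 1)` of `M`, so passing to `M / rM` costs one degree of vanishing. Quotients of
ZD-modules are ZD. -/
theorem exists_isWeaklyRegular_of_subsingleton_ext [IsNoetherianRing R] {a : Ideal R} (t : ℕ)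
    (M : Type u) [AddCommGroup M] [Module R M] (hM : IsZDModule R M)
    (hext : ∀ i < t, Subsingleton (Ext (ModuleCat.of R (R ⧸ a)) (ModuleCat.of R M) i)) :
    ∃ rs : List R, rs.length = t ∧ (∀ r ∈ rs, r ∈ a) ∧
      RingTheory.Sequence.IsWeaklyRegular M rs := by
  induction t generalizing M with
  | zero => exact ⟨[], rfl, by simp, RingTheory.Sequence.IsWeaklyRegular.nil R M⟩
  | succ t ih =>
    have := hext 0 t.succ_pos
    obtain ⟨r, hra, hr⟩ := hM.exists_isSMulRegular
      (torsion_bot_eq_bot_of_subsingleton_ext (a := a) (M := ModuleCat.of R M))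
    obtain ⟨rs, hlen, hmem, hreg⟩ := ih (QuotSMulTop r M)
      (hM.of_surjective _ (Submodule.mkQ_surjective _)) fun i hi => by
        have h1 := hext i (by lia)
        have h2 := hext (i + 1) (by lia)
        have hS : (ModuleCat.smulShortComplex (ModuleCat.of R M) r).ShortExact :=
          IsSMulRegular.smulShortComplex_shortExact hr
        have hz : ∀ x : Ext (ModuleCat.of R (R ⧸ a))
            (ModuleCat.smulShortComplex (ModuleCat.of R M) r).X₃ i, x = 0 := fun x => by
          obtain ⟨y, rfl⟩ := Ext.covariant_sequence_exact₃ _ hS x rfl (h2.elim _ _)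
          rw [show y = 0 from h1.elim _ _, Ext.zero_comp]
        exact subsingleton_of_forall_eq 0 hz
    exact ⟨r :: rs, by simp [hlen], by simpa using ⟨hra, hmem⟩,
      RingTheory.Sequence.IsWeaklyRegular.cons hr hreg⟩

theorem isRegular_of_isWeaklyRegular {M : Type*} [AddCommGroup M] [Module R M] {a : Ideal R}
    {rs : List R} (hrs : RingTheory.Sequence.IsWeaklyRegular M rs) (hmem : ∀ r ∈ rs, r ∈ a)
    (ha : a • (⊤ : Submodule R M) ≠ ⊤) : RingTheory.Sequence.IsRegular M rs where
  toIsWeaklyRegular := hrs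
  top_ne_smul h := ha (top_le_iff.1 (h.le.trans
    (Submodule.smul_mono_left (Ideal.span_le.2 hmem))))

theorem nonempty_torsion_cosyzygy_equiv {I J : Ideal R} {M : Type u} [AddCommGroup M] [Module R M]
    {t : ℕ} (h : ∀ i < t, torsion I J (hull (cosyzygy (ModuleCat.of R M) i)) = ⊥) :
    Nonempty (torsion I J (cosyzygy (ModuleCat.of R M) t) ≃ₗ[R] pairH I J t M) := by
  have := isIso_torsionToH h
  exact ⟨(asIso (torsionToH I J (ModuleCat.of R M) t)).toLinearEquiv⟩

end Ext

end PairLocalCohomology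

/-! ### The main theorem. -/

open PairLocalCohomology in
theorem theorem2p6 {R : Type u} [CommRing R] [IsNoetherianRing R] (I J : Ideal R)
    (M : Type u) [AddCommGroup M] [Module R M] (t : ℕ)
    (hM : ∀ i < t, Limits.IsZero (PairLocalCohomology.pairH I J i M))
    (a : Ideal R) (ha : a ∈ PairLocalCohomology.WTilde I J) :
    -- (i)
    (Nonempty (((R ⧸ a) →ₗ[R] PairLocalCohomology.ordH a t M) ≃ₗ[R]
        Abelian.Ext (ModuleCat.of R (R ⧸ a)) (ModuleCat.of R M) t) ∧
      Nonempty (Abelian.Ext (ModuleCat.of R (R ⧸ a)) (ModuleCat.of R M) t ≃ₗ[R]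
        ((R ⧸ a) →ₗ[R] PairLocalCohomology.pairH a J t M)) ∧
      Nonempty (((R ⧸ a) →ₗ[R] PairLocalCohomology.pairH a J t M) ≃ₗ[R]
        ((R ⧸ a) →ₗ[R] PairLocalCohomology.pairH I J t M))) ∧
    -- (ii)
    (Nonempty (PairLocalCohomology.torsion a ⊥ (PairLocalCohomology.ordH a t M) ≃ₗ[R]
        PairLocalCohomology.ordH a t M) ∧
      Nonempty (PairLocalCohomology.ordH a t M ≃ₗ[R]
        PairLocalCohomology.torsion a ⊥ (PairLocalCohomology.pairH a J t M)) ∧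
      Nonempty (PairLocalCohomology.torsion a ⊥ (PairLocalCohomology.pairH a J t M) ≃ₗ[R]
        PairLocalCohomology.torsion a ⊥ (PairLocalCohomology.pairH I J t M))) ∧
    -- (iii), (iv), (v)
    (∀ i ≤ t, Function.Injective (PairLocalCohomology.ordToPair a J i M)) ∧
    (∀ i ≤ t, Function.Injective (PairLocalCohomology.pairToPair ha i M)) ∧
    (∀ i ≤ t, Function.Injective (PairLocalCohomology.ordToPairOfMem ha i M)) ∧
    -- (vi)
    (∀ i < t, Limits.IsZero (PairLocalCohomology.pairH a J i M) ∧
      Limits.IsZero (PairLocalCohomology.ordH a i M)) ∧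
    -- (vii)
    (associatedPrimes R (PairLocalCohomology.ordH a t M) =
        associatedPrimes R (PairLocalCohomology.pairH a J t M) ∩ {p | a ≤ p} ∧
      associatedPrimes R (PairLocalCohomology.pairH a J t M) ∩ {p | a ≤ p} =
        associatedPrimes R (PairLocalCohomology.pairH I J t M) ∩ {p | a ≤ p}) ∧
    -- (viii)
    (a ≠ ⊥ → PairLocalCohomology.IsZDModule R M →
      ∃ rs : List R, rs.length = t ∧ (∀ r ∈ rs, r ∈ a) ∧
        RingTheory.Sequence.IsWeaklyRegular M rs ∧
        (a • (⊤ : Submodule R M) ≠ ⊤ → RingTheory.Sequence.IsRegular M rs)) := by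

  have hIJ := torsion_hull_cosyzygy_eq_bot hM
  have haJ : ∀ i < t, torsion a J (hull (cosyzygy (ModuleCat.of R M) i)) = ⊥ := fun i hi =>
    eq_bot_iff.2 ((torsion_le_of_mem_WTilde ha _).trans (hIJ i hi).le)
  have ha0 : ∀ i < t, torsion a ⊥ (hull (cosyzygy (ModuleCat.of R M) i)) = ⊥ := fun i hi =>
    eq_bot_iff.2 ((torsion_bot_le a J _).trans (haJ i hi).le)
  obtain ⟨eIJ⟩ := nonempty_torsion_cosyzygy_equiv hIJ
  obtain ⟨eaJ⟩ := nonempty_torsion_cosyzygy_equiv haJ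
  obtain ⟨ea⟩ := nonempty_torsion_cosyzygy_equiv ha0
  obtain ⟨eExt⟩ := nonempty_ext_equiv_linearMap ha0
  -- All three torsion submodules of the `t`-th cosyzygy contain its `a`-torsion; this is all that
  -- (i), (ii) and (vii) need in order to compare them.
  have leaJ := torsion_bot_le a J (cosyzygy (ModuleCat.of R M) t)
  have leIJ := leaJ.trans (torsion_le_of_mem_WTilde ha _)
  have homa := (LinearEquiv.congrRight (M := R ⧸ a) ea).symm.trans (homSubmoduleEquiv le_rfl)
  have homaJ := (LinearEquiv.congrRight (M := R ⧸ a) eaJ).symm.trans (homSubmoduleEquiv leaJ)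
  have homIJ := (LinearEquiv.congrRight (M := R ⧸ a) eIJ).symm.trans (homSubmoduleEquiv leIJ)
  have tora := (torsionCongr a ⊥ ea).symm.trans (torsionSubmoduleEquiv a ⊥ le_rfl)
  have toraJ := (torsionCongr a ⊥ eaJ).symm.trans (torsionSubmoduleEquiv a ⊥ leaJ)
  have torIJ := (torsionCongr a ⊥ eIJ).symm.trans (torsionSubmoduleEquiv a ⊥ leIJ)
  refine ⟨⟨⟨homa.trans eExt.symm⟩, ⟨eExt.trans homaJ.symm⟩, ⟨homaJ.trans homIJ.symm⟩⟩,
    ⟨⟨tora.trans ea⟩, ⟨ea.symm.trans toraJ.symm⟩, ⟨toraJ.trans torIJ.symm⟩⟩,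
    fun i hi => injective_rightDerived_torsionInclusion _ fun j hj => haJ j (hj.trans_le hi),
    fun i hi => injective_rightDerived_torsionInclusion _ fun j hj => hIJ j (hj.trans_le hi),
    fun i hi => injective_rightDerived_torsionInclusion _ fun j hj => hIJ j (hj.trans_le hi),
    fun i hi => ⟨isZero_rightDerived_torsionFunctor fun j hj => haJ j (hj.trans_lt hi),
      isZero_rightDerived_torsionFunctor fun j hj => ha0 j (hj.trans_lt hi)⟩,
    ⟨?_, ?_⟩, fun _ hZD => ?_⟩
  · rw [← LinearEquiv.AssociatedPrimes.eq ea, ← LinearEquiv.AssociatedPrimes.eq eaJ,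
      associatedPrimes_torsion_inter leaJ,
      ← associatedPrimes_torsion_inter le_rfl]
    exact (Set.inter_eq_left.2 fun p hp => le_of_mem_associatedPrimes_torsion hp).symm
  · rw [← LinearEquiv.AssociatedPrimes.eq eaJ, ← LinearEquiv.AssociatedPrimes.eq eIJ,
      associatedPrimes_torsion_inter leaJ,      associatedPrimes_torsion_inter leIJ]
  · obtain ⟨rs, hlen, hmem, hreg⟩ := exists_isWeaklyRegular_of_subsingleton_ext (a := a) t M hZD
      fun i hi => by
        -- For `i < t`, `Ext i` is `Hom(R/a, Cⁱ)`, which is zero because `Cⁱ` embeds in a hull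
        -- without `a`-torsion.
        obtain ⟨e⟩ := nonempty_ext_equiv_linearMap fun j hj => ha0 j (hj.trans hi)
        refine e.toEquiv.subsingleton_congr.2 (subsingleton_of_forall_eq 0 fun f => ?_)
        have hi0 : torsion a ⊥ (cosyzygy (ModuleCat.of R M) i) = ⊥ :=
          torsion_eq_bot_of_hull (ha0 i hi)
        exact LinearMap.ext fun y => by
          simpa [hi0] using mem_torsion_bot_of_linearMap f y
    exact ⟨rs, hlen, hmem, hreg, isRegular_of_isWeaklyRegular hreg hmem⟩
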